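/- Let $q$ be a prime power. Points and lines are sequences over $\mathbb F_q$ with coordinates $(p)=(p_1,p_{11},p_{12},p_{21},p_{22},p'_{22},p_{23},p_{32},\dots,p_{ii},p'_{ii},p_{i,i+1},p_{i+1,i},\dots)$ and $[l]=[l_1,l_{11},l_{12},l_{21},l_{22},l'_{22},l_{23},l_{32},\dots,l_{ii},l'_{ii},l_{i,i+1},l_{i+1,i},\dots]$, respectively. In the bipartite graph $D(q)$ the point $(p)$ is adjacent to the line $[l]$ iff $$l_{11}-p_{11}=l_1p_1,\quad l_{12}-p_{12}=l_{11}p_1,\quad l_{21}-p_{21}=l_1p_{11},$$ and, for all $i\ge 2$, $$l_{ii}-p_{ii}=l_1p_{i-1,i},\quad l'_{ii}-p'_{ii}=l_{i,i-1}p_1,\quad l_{i,i+1}-p_{i,i+1}=l_{ii}p_1,\quad l_{i+1,i}-p_{i+1,i}=l_1p'_{ii}.$$ $D(n,q)$ is the graph obtained by keeping only the first $n$ coordinates and the first $n-1$ relations. In each of these graphs let $N_\alpha$ ($\alpha\in\mathbb F_q$) send a vertex $v$ to its unique neighbour whose first coordinate is that of $v$ plus $\alpha$. Let $GD(\mathbb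 F_q)$ and $GD(n,\mathbb F_q)$ be the groups of permutations of the vertices of $D(q)$ and $D(n,q)$ generated by the operators of walks $N_{\alpha_1},N_{\alpha_2},\dots,N_{\alpha_{2s}}$ (performed in this order) of even length, and let $\phi_n:GD(\mathbb F_q)\to GD(n,\mathbb F_q)$ be the canonical homomorphism, induced by deleting all coordinates after the $n$-th. An element $g\in GD(\mathbb F_q)$ is called regular of length $k\ge 1$ if it is the operator of a walk $N_{\alpha_1},\dots,N_{\alpha_{2k}}$ with $\alpha_i+\alpha_{i+1}\ne 0$ for $1\le i<2k$ (a walk without backtracking). The degree of a map $\mathbb F_q^n\to\mathbb F_q^n$ is the least $d$ such that all its components are given by polynomials of total degree at most $d$. (1) Every nonidentity element of $GD(\mathbb F_q)$ has infinite order. (2) Let $g\in GD(\mathbb F_q)$ be regular of length $k$. If $n\ge 2$ and $k\le (n+5)/2$, then the order of $\phi_n(g)$ is at least $(n+5)/(4k)$. (3) Let $g\in GD(\mathbb F_q)$ be regular of length $k$, and let $g_n$ be the permutation of the points $\mathbb F_q^n$ of $D(n,q)$ induced by $\phi_n(g)$. All powers of $g_n$ have degree at most $3$, for every $n$. If $q\ge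 3$, then $(g_n)$ is a sequence of stable degree $3$: the order of $g_n$ tends to infinity with $n$; the maximal degree of an element of the cyclic group $\langle g_n\rangle$ is $3$ for all sufficiently large $n$; and for every integer $m\ne 0$ the power $g_n^m$ has degree exactly $3$ for all sufficiently large $n$ (depending on $m$). -/

import Mathlib

open Filter

namespace WalkForest

/-- The coordinate positions `0, 1, 2, …` below `N`.  The case `N = ⊤` serves the infinite
graph `D(K)`, the case `N = n` its truncation `D(n, K)`. -/
abbrev Idx (N : ℕ∞) : Type := {j : ℕ // (j : ℕ∞) < N}

/-- Points and lines are both vectors of length `N` over `K`; `Sum.inl p` is the point `(p)`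
and `Sum.inr l` the line `[l]`. -/
abbrev Vertex (N : ℕ∞) (K : Type*) : Type _ := (Idx N → K) ⊕ (Idx N → K)

variable {N : ℕ∞} {K : Type*} [CommRing K]

/-- The coordinate at position `j` of a vector of length `N`, with the value `0` beyond `N`. -/
def coord (v : Idx N → K) (j : ℕ) : K := if h : (j : ℕ∞) < N then v ⟨j, h⟩ else 0

/-- The right-hand side of the defining relation of position `j ≥ 1`.
The coordinates `v₁, v₁₁, v₁₂, v₂₁, v₂₂, v'₂₂, v₂₃, v₃₂, …, v_{ii}, v'_{ii}, v_{i,i+1}, v_{i+1,i}, …`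
stand at the positions `0, 1, 2, 3, 4, 5, 6, 7, …`; for `i ≥ 2` the four coordinates
`v_{ii}, v'_{ii}, v_{i,i+1}, v_{i+1,i}` stand at `4(i-1), 4(i-1)+1, 4(i-1)+2, 4(i-1)+3`.  So
* position 1: `l₁₁ - p₁₁ = l₁ p₁`; position 2: `l₁₂ - p₁₂ = l₁₁ p₁`;
  position 3: `l₂₁ - p₂₁ = l₁ p₁₁`;
* `j = 4(i-1)`: `l_{ii} - p_{ii} = l₁ p_{i-1,i}`;
* `j = 4(i-1)+1`: `l'_{ii} - p'_{ii} = l_{i,i-1} p₁`;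
* `j = 4(i-1)+2`: `l_{i,i+1} - p_{i,i+1} = l_{ii} p₁`;
* `j = 4(i-1)+3`: `l_{i+1,i} - p_{i+1,i} = l₁ p'_{ii}`. -/
def rhs (p l : ℕ → K) (j : ℕ) : K :=
  if j = 1 then l 0 * p 0
  else if j = 2 then l 1 * p 0
  else if j % 4 = 0 ∨ j % 4 = 3 then l 0 * p (j - 2)
  else l (j - 2) * p 0

/-- Incidence of the point `p` and the line `l`: the first `N - 1` relations hold. -/
def Incident (p l : Idx N → K) : Prop :=
  ∀ j : ℕ, 1 ≤ j → (j : ℕ∞) < N → coord l j - coord p j = rhs (coord p) (coord l) j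

/-- Adjacency in the incidence graph. -/
def Adjacent : Vertex N K → Vertex N K → Prop
  | .inl p, .inr l => Incident p l
  | .inr l, .inl p => Incident p l
  | _, _ => False

/-- The incidence graph `D(N, K)` on points and lines. -/
def graph (N : ℕ∞) (K : Type*) [CommRing K] : SimpleGraph (Vertex N K) where
  Adj := Adjacent
  symm := ⟨by rintro (p | l) (p' | l') h <;> exact h⟩
  loopless := ⟨by rintro (p | l) h <;> exact h⟩

/-- The first coordinate of a vertex. -/
def first : Vertex N K → K
  | .inl p => coord p 0
  | .inr l => coord l 0

/-- The colour of the arrow from `v` to `w`. -/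
def colour (v w : Vertex N K) : K := first w - first v

/-- The coordinates of the line through the point `p` with first coordinate `x`. -/
def lineSeq (p : ℕ → K) (x : K) : ℕ → K
  | 0 => x
  | 1 => p 1 + x * p 0
  | 2 => p 2 + lineSeq p x 1 * p 0
  | j + 3 => p (j + 3) +
      if (j + 3) % 4 = 0 ∨ (j + 3) % 4 = 3 then x * p (j + 1) else lineSeq p x (j + 1) * p 0

/-- The coordinates of the point on the line `l` with first coordinate `y`. -/
def pointSeq (l : ℕ → K) (y : K) : ℕ → K
  | 0 => y
  | 1 => l 1 - l 0 * y
  | 2 => l 2 - l 1 * y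
  | j + 3 => l (j + 3) -
      if (j + 3) % 4 = 0 ∨ (j + 3) % 4 = 3 then l 0 * pointSeq l y (j + 1) else l (j + 1) * y

/-- The neighbour of a vertex along the arrow of colour `α`. -/
def step (α : K) : Vertex N K → Vertex N K
  | .inl p => .inr fun j => lineSeq (coord p) (coord p 0 + α) j
  | .inr l => .inl fun j => pointSeq (coord l) (coord l 0 + α) j

lemma coord_of_lt (v : Idx N → K) {j : ℕ} (h : (j : ℕ∞) < N) : coord v j = v ⟨j, h⟩ := by
  simp [coord, h]

lemma lt_of_le_lt {i j : ℕ} (hij : i ≤ j) (h : (j : ℕ∞) < N) : (i : ℕ∞) < N :=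
  lt_of_le_of_lt (by exact_mod_cast hij) h

lemma incident_iff_line (p l : Idx N → K) :
    Incident p l ↔ ∀ j : ℕ, (j : ℕ∞) < N → coord l j = lineSeq (coord p) (coord l 0) j := by
  constructor
  · intro h j
    induction j using Nat.strong_induction_on with
    | _ j ih =>
      intro hj
      match j, ih, hj with
      | 0, _, _ => simp [lineSeq]
      | 1, _, hj =>
        have := h 1 le_rfl hj
        simp only [rhs, if_true] at this
        simp only [lineSeq]; linear_combination this
      | 2, ih, hj =>
        have := h 2 (by norm_num) hj
        have h1 := ih 1 (by norm_num) (lt_of_le_lt (by norm_num) hj)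
        simp [rhs] at this
        rw [lineSeq, ← h1]; linear_combination this
      | j + 3, ih, hj =>
        have := h (j + 3) (by omega) hj
        have h1 := ih (j + 1) (by omega) (lt_of_le_lt (by omega) hj)
        simp only [rhs, show j + 3 ≠ 1 by omega, show j + 3 ≠ 2 by omega, if_false,
          show j + 3 - 2 = j + 1 by omega] at this
        rw [lineSeq, ← h1, ← this]; ring
  · intro h j h1 hj
    match j, h1, hj with
    | 1, _, hj =>
      rw [h 1 hj]; simp [rhs, lineSeq]
    | 2, _, hj =>
      rw [h 2 hj]
      simp only [rhs, lineSeq]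
      rw [h 1 (lt_of_le_lt (by norm_num) hj)]; simp [lineSeq]
    | j + 3, _, hj =>
      rw [h (j + 3) hj]
      simp only [rhs, show j + 3 ≠ 1 by omega, show j + 3 ≠ 2 by omega, if_false,
          show j + 3 - 2 = j + 1 by omega, lineSeq]
      rw [h (j + 1) (lt_of_le_lt (by omega) hj)]; ring

lemma incident_iff_point (p l : Idx N → K) :
    Incident p l ↔ ∀ j : ℕ, (j : ℕ∞) < N → coord p j = pointSeq (coord l) (coord p 0) j := by
  constructor
  · intro h j
    induction j using Nat.strong_induction_on with
    | _ j ih =>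
      intro hj
      match j, ih, hj with
      | 0, _, _ => simp [pointSeq]
      | 1, _, hj =>
        have := h 1 le_rfl hj
        simp only [rhs, if_true] at this
        simp only [pointSeq]; linear_combination -this
      | 2, ih, hj =>
        have := h 2 (by norm_num) hj
        simp [rhs] at this
        rw [pointSeq]; linear_combination -this
      | j + 3, ih, hj =>
        have := h (j + 3) (by omega) hj
        have h1 := ih (j + 1) (by omega) (lt_of_le_lt (by omega) hj)
        simp only [rhs, show j + 3 ≠ 1 by omega, show j + 3 ≠ 2 by omega, if_false,
          show j + 3 - 2 = j + 1 by omega] at this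
        rw [pointSeq, ← h1, ← this]; ring
  · intro h j h1 hj
    match j, h1, hj with
    | 1, _, hj =>
      rw [h 1 hj]; simp [rhs, pointSeq]
    | 2, _, hj =>
      rw [h 2 hj]; simp [rhs, pointSeq]
    | j + 3, _, hj =>
      rw [h (j + 3) hj]
      simp only [rhs, show j + 3 ≠ 1 by omega, show j + 3 ≠ 2 by omega, if_false,
          show j + 3 - 2 = j + 1 by omega, pointSeq]
      rw [h (j + 1) (lt_of_le_lt (by omega) hj)]; ring

/-- `step α v` is the one and only neighbour of `v` along an arrow of colour `α`. -/
theorem adj_and_colour_iff (hN : 0 < N) (α : K) (v w : Vertex N K) :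
    ((graph N K).Adj v w ∧ colour v w = α) ↔ w = step α v := by
  have h0 : ((0 : ℕ) : ℕ∞) < N := by simpa using hN
  rcases v with p | l <;> rcases w with p' | l'
  · simp [graph, Adjacent, step]
  · simp only [graph, Adjacent, step, colour, first, Sum.inr.injEq, incident_iff_line]
    constructor
    · rintro ⟨h, hα⟩
      funext ⟨j, hj⟩
      rw [← coord_of_lt l' hj, h j hj, ← hα]; simp
    · rintro rfl
      refine ⟨fun j hj => ?_, ?_⟩
      · rw [coord_of_lt _ hj, coord_of_lt (fun j : Idx N => lineSeq _ _ j.1) h0]; simp [lineSeq]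
      · rw [coord_of_lt (fun j : Idx N => lineSeq _ _ j.1) h0]; simp [lineSeq]
  · simp only [graph, Adjacent, step, colour, first, Sum.inl.injEq, incident_iff_point]
    constructor
    · rintro ⟨h, hα⟩
      funext ⟨j, hj⟩
      rw [← coord_of_lt p' hj, h j hj, ← hα]; simp
    · rintro rfl
      refine ⟨fun j hj => ?_, ?_⟩
      · rw [coord_of_lt _ hj, coord_of_lt (fun j : Idx N => pointSeq _ _ j.1) h0]; simp [pointSeq]
      · rw [coord_of_lt (fun j : Idx N => pointSeq _ _ j.1) h0]; simp [pointSeq]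
  · simp [graph, Adjacent, step]

lemma step_neg_step (α : K) (v : Vertex N K) : step (-α) (step α v) = v := by
  by_cases hN : 0 < N
  · obtain ⟨h1, h2⟩ := (adj_and_colour_iff hN α v (step α v)).2 rfl
    refine ((adj_and_colour_iff hN (-α) (step α v) v).1 ⟨h1.symm, ?_⟩).symm
    calc colour (step α v) v = -colour v (step α v) := by simp [colour]
      _ = -α := by rw [h2]
  · have hE : IsEmpty (Idx N) := ⟨fun j => hN (lt_of_le_of_lt (zero_le) j.2)⟩
    rcases v with p | l
    · exact congrArg Sum.inl (Subsingleton.elim _ _)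
    · exact congrArg Sum.inr (Subsingleton.elim _ _)

/-- The operator `N_α`, a permutation of the vertices: move along the arrow of colour `α`. -/
def stepPerm (N : ℕ∞) (α : K) : Equiv.Perm (Vertex N K) where
  toFun := step α
  invFun := step (-α)
  left_inv := step_neg_step α
  right_inv v := by simpa using step_neg_step (-α) v

/-- The walk operator of `α₁, …, α_m`: first `N_{α₁}`, then `N_{α₂}`, and so on. -/
def walk (N : ℕ∞) : List K → Equiv.Perm (Vertex N K)
  | [] => 1
  | α :: w => walk N w * stepPerm N α

/-- The group generated by the walk operators of even length, acting on points and lines: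
`GD(K)` for `N = ⊤` and `GD(n, K)` for `N = n`. -/
def GD (N : ℕ∞) (K : Type*) [CommRing K] : Subgroup (Equiv.Perm (Vertex N K)) :=
  Subgroup.closure {g | ∃ w : List K, Even w.length ∧ g = walk N w}

/-- Deleting all coordinates beyond the first `n`. -/
def trunc (n : ℕ) : Vertex ⊤ K → Vertex n K :=
  Sum.map (fun v j => v ⟨j.1, ENat.natCast_lt_top _⟩) (fun v j => v ⟨j.1, ENat.natCast_lt_top _⟩)

lemma trunc_surjective (n : ℕ) : Function.Surjective (trunc n : Vertex ⊤ K → Vertex n K) := by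
  rintro (p | l)
  · refine ⟨.inl fun j => coord p j.1, congrArg Sum.inl ?_⟩
    funext j; exact coord_of_lt p j.2
  · refine ⟨.inr fun j => coord l j.1, congrArg Sum.inr ?_⟩
    funext j; exact coord_of_lt l j.2

lemma lineSeq_congr {p p' : ℕ → K} (x : K) (j : ℕ) (h : ∀ i ≤ j, p i = p' i) :
    lineSeq p x j = lineSeq p' x j := by
  induction j using Nat.strong_induction_on with
  | _ j ih =>
    match j, ih, h with
    | 0, _, _ => simp [lineSeq]
    | 1, _, h => simp [lineSeq, h 0, h 1]
    | 2, ih, h => simp [lineSeq, h 0, h 1, h 2]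
    | j + 3, ih, h =>
      simp only [lineSeq]
      rw [ih (j + 1) (by omega) (fun i hi => h i (by omega)), h 0 (by omega),
        h (j + 1) (by omega), h (j + 3) le_rfl]

lemma pointSeq_congr {l l' : ℕ → K} (y : K) (j : ℕ) (h : ∀ i ≤ j, l i = l' i) :
    pointSeq l y j = pointSeq l' y j := by
  induction j using Nat.strong_induction_on with
  | _ j ih =>
    match j, ih, h with
    | 0, _, _ => simp [pointSeq]
    | 1, _, h => simp [pointSeq, h 0, h 1]
    | 2, ih, h => simp [pointSeq, h 1, h 2]
    | j + 3, ih, h =>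
      simp only [pointSeq]
      rw [ih (j + 1) (by omega) (fun i hi => h i (by omega)), h 0 (by omega),
        h (j + 1) (by omega), h (j + 3) le_rfl]

lemma trunc_step (n : ℕ) (α : K) (v : Vertex ⊤ K) : trunc n (step α v) = step α (trunc n v) := by
  have key : ∀ (u : Idx ⊤ → K) (j : Idx (n : ℕ∞)) (i : ℕ), i ≤ j.1 → coord u i =
      coord (N := (n : ℕ∞)) (fun j => u ⟨j.1, ENat.natCast_lt_top _⟩) i := by
    intro u j i hi
    rw [coord_of_lt u (ENat.natCast_lt_top i), coord_of_lt _ (lt_of_le_lt hi j.2)]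
  rcases v with p | l
  · refine congrArg Sum.inr (funext fun j => ?_)
    change lineSeq _ _ j.1 = lineSeq _ _ j.1
    rw [key p j 0 (Nat.zero_le _)]
    exact lineSeq_congr _ _ (key p j)
  · refine congrArg Sum.inl (funext fun j => ?_)
    change pointSeq _ _ j.1 = pointSeq _ _ j.1
    rw [key l j 0 (Nat.zero_le _)]
    exact pointSeq_congr _ _ (key l j)

lemma trunc_walk (n : ℕ) (w : List K) (v : Vertex ⊤ K) :
    trunc n (walk ⊤ w v) = walk n w (trunc n v) := by
  induction w generalizing v with
  | nil => rfl
  | cons α w ih =>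
    change trunc n (walk ⊤ w (step α v)) = walk n w (step α (trunc n v))
    rw [ih, trunc_step]

lemma exists_image (n : ℕ) (g : GD ⊤ K) :
    ∃ h : GD (n : ℕ∞) K, ∀ v, trunc n (g.1 v) = h.1 (trunc n v) := by
  obtain ⟨g, hg⟩ := g
  induction hg using Subgroup.closure_induction with
  | mem g hg =>
    obtain ⟨w, hw, rfl⟩ := hg
    exact ⟨⟨walk n w, Subgroup.subset_closure ⟨w, hw, rfl⟩⟩, trunc_walk n w⟩
  | one => exact ⟨1, fun v => rfl⟩
  | mul a b _ _ iha ihb =>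
    obtain ⟨a', ha⟩ := iha
    obtain ⟨b', hb⟩ := ihb
    exact ⟨a' * b', fun v => (ha _).trans (congrArg a'.1 (hb v))⟩
  | inv a _ iha =>
    obtain ⟨a', ha⟩ := iha
    refine ⟨a'⁻¹, fun v => ?_⟩
    have h1 := ha (a⁻¹ v)
    have h2 : a (a⁻¹ v) = v := a.apply_symm_apply v
    have h3 : trunc n v = a'.1 (trunc n (a⁻¹ v)) := by rw [← h1, h2]
    exact (Equiv.eq_symm_apply a'.1).2 h3.symm

lemma image_unique (n : ℕ) {g : Vertex ⊤ K → Vertex ⊤ K} {h h' : GD (n : ℕ∞) K}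
    (H : ∀ v, trunc n (g v) = h.1 (trunc n v)) (H' : ∀ v, trunc n (g v) = h'.1 (trunc n v)) :
    h = h' := by
  refine Subtype.ext (Equiv.ext fun x => ?_)
  obtain ⟨v, rfl⟩ := trunc_surjective n x
  rw [← H, ← H']

/-- The canonical homomorphism `φ_n` from `GD(K)` to `GD(n, K)`: the image of `g` is the
permutation that `g` induces on the truncated vertices. -/
noncomputable def phi (n : ℕ) : GD ⊤ K →* GD (n : ℕ∞) K :=
  MonoidHom.mk' (fun g => (exists_image n g).choose) fun a b =>
    image_unique n (g := (a * b).1) (exists_image n (a * b)).choose_spec fun v =>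
      ((exists_image n a).choose_spec _).trans
        (congrArg _ ((exists_image n b).choose_spec v))

theorem phi_trunc (n : ℕ) (g : GD ⊤ K) (v : Vertex ⊤ K) :
    trunc n (g.1 v) = (phi n g).1 (trunc n v) :=
  (exists_image n g).choose_spec v

lemma isLeft_walk (w : List K) (v : Vertex N K) :
    (walk N w v).isLeft = if Even w.length then v.isLeft else !v.isLeft := by
  induction w generalizing v with
  | nil => simp [walk]
  | cons α w ih =>
    change (walk N w (step α v)).isLeft = _
    rw [ih]
    have : (step α v).isLeft = !v.isLeft := by rcases v with p | l <;> rfl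
    rw [this]
    by_cases h : Even w.length <;> simp [h, Nat.even_add_one]

lemma isLeft_apply (g : GD N K) (v : Vertex N K) : (g.1 v).isLeft = v.isLeft := by
  obtain ⟨g, hg⟩ := g
  induction hg using Subgroup.closure_induction generalizing v with
  | mem g hg =>
    obtain ⟨w, hw, rfl⟩ := hg
    simp [isLeft_walk, hw]
  | one => rfl
  | mul a b _ _ iha ihb => exact (iha _).trans (ihb v)
  | inv a _ iha => simpa using (iha (a⁻¹ v)).symm

/-- The point to which `g` moves the point `p`. -/
def pointMap (g : GD N K) (p : Idx N → K) : Idx N → K :=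
  (g.1 (.inl p)).getLeft ((isLeft_apply g (.inl p)).trans rfl)

theorem inl_pointMap (g : GD N K) (p : Idx N → K) : Sum.inl (pointMap g p) = g.1 (.inl p) :=
  Sum.inl_getLeft _ _

lemma pointMap_mul (a b : GD N K) (p : Idx N → K) :
    pointMap (a * b) p = pointMap a (pointMap b p) := by
  refine Sum.inl_injective (β := Idx N → K) ?_
  rw [inl_pointMap, inl_pointMap, inl_pointMap]; rfl

lemma pointMap_one (p : Idx N → K) : pointMap (1 : GD N K) p = p :=
  Sum.inl_injective (inl_pointMap 1 p)

/-- The action of `GD(N, K)` on the points. -/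
def pointAction : GD N K →* Equiv.Perm (Idx N → K) :=
  MonoidHom.mk'
    (fun g =>
      { toFun := pointMap g
        invFun := pointMap g⁻¹
        left_inv := fun p => by rw [← pointMap_mul, inv_mul_cancel, pointMap_one]
        right_inv := fun p => by rw [← pointMap_mul, mul_inv_cancel, pointMap_one] })
    fun a b => Equiv.ext (pointMap_mul a b)

/-- `g` is a regular (irreducible) element of length `k`: the operator of a walk of length `2k`
that never goes back along the arrow it has just used.  Going back along an arrow of colour `α`
means using colour `-α` next. -/
def IsRegular (g : GD ⊤ K) (k : ℕ) : Prop :=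
  ∃ w : List K, w.length = 2 * k ∧ w.IsChain (fun a b => a + b ≠ 0) ∧ g.1 = walk ⊤ w

/-- The map `f` is given by polynomials of total degree at most `d`. -/
def HasDegreeLE {ι : Type*} (f : (ι → K) → ι → K) (d : ℕ) : Prop :=
  ∃ P : ι → MvPolynomial ι K, (∀ i, (P i).totalDegree ≤ d) ∧
    ∀ x i, MvPolynomial.eval x (P i) = f x i

/-- `f` is a polynomial map of degree `d`. -/
def HasDegree {ι : Type*} (f : (ι → K) → ι → K) (d : ℕ) : Prop :=
  IsLeast {e | HasDegreeLE f e} d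

/-- A sequence of groups of polynomial bijections of `K^n` is of stable degree `c`: the maximal
degree of an element of `G n` is `c`, for all sufficiently large `n`. -/
def IsStableFamily (c : ℕ) (G : ∀ n : ℕ, Subgroup (Equiv.Perm (Idx (n : ℕ∞) → K))) : Prop :=
  ∀ᶠ n : ℕ in atTop, (∀ g ∈ G n, ∃ d, HasDegree g d) ∧
    IsGreatest {d | ∃ g ∈ G n, HasDegree g d} c

/-- A sequence of polynomial bijections `f n` of `K^n` (`K` finite) is of stable degree `c`:
the order of `f n` grows to infinity, the cyclic groups generated by the `f n` form a family of
stable degree `c`, and each nontrivial power of `f n` has degree exactly `c` as soon as `n` is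
large compared with the exponent. -/
def IsStableSequence [Finite K] (c : ℕ) (f : ∀ n : ℕ, Equiv.Perm (Idx (n : ℕ∞) → K)) : Prop :=
  Tendsto (fun n : ℕ => orderOf (f n)) atTop atTop ∧
  IsStableFamily c (fun n => Subgroup.zpowers (f n)) ∧
  ∀ m : ℤ, m ≠ 0 → ∀ᶠ n : ℕ in atTop, HasDegree ((f n ^ m) : Equiv.Perm _) c

end WalkForest

/-! Two moves with colours α, β from a point to a point change `p_1` by α + β, and change about half
of the other coordinates by -(α + β) times a coordinate of the line in between. Moves from line to
line behave in the same way. Everything rests on these scalar multipliers.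

Upper bound on the degree: the coordinates updated in this way start out at most quadratic and only
ever receive constant multiples of one another, so they stay quadratic however long the walk is
(`QuadraticFlag`). The remaining point coordinates are read off once, at the end, as a line
coordinate minus `l_1` times a quadratic, hence are cubic (`hasDegreeLE_pointMap`).

Orders: read `p_1, p_12, p_23, …` and `-1, l_11, l_22, …` as power series X, Y in z. A walk acts on
them by X ↦ X - (α + β)Y and Y ↦ Y + (α + β)zX. Without backtracking all multipliers are nonzero, so
the top coefficient of Y climbs one place per two steps and never vanishes
(`exists_chain_transfer`). Hence a reduced walk moves the zero point in an explicit coordinate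
(`walk_zero_ne`). Up to conjugation a power of a walk is again a reduced walk
(`exists_cyclically_reduced`), which gives infinite order and the lower bound.

Exact degree: switching `p_12` from 0 to 1 changes a late coordinate of the image by a true
quadratic in `p_1` (`walk_difference`), while for a map of degree at most 2 this change is affine in
`p_1` (`IsPolyLE.exists_sub_eq_affine`). Three field elements tell the two apart. -/

namespace WalkForest
-- Coordinates after one and two moves
section Steps

variable {N : ℕ∞} {K : Type*} [CommRing K]

/-- The line reached from the point `p` along the arrow of colour `α`. -/
def lineOf (p : Idx N → K) (α : K) : Idx N → K :=
  fun j => lineSeq (coord p) (coord p 0 + α) j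

/-- The point reached from the line `l` along the arrow of colour `α`. -/
def pointOf (l : Idx N → K) (α : K) : Idx N → K :=
  fun j => pointSeq (coord l) (coord l 0 + α) j

lemma step_inl (α : K) (p : Idx N → K) : step α (.inl p) = .inr (lineOf p α) := rfl

lemma coord_lineOf (p : Idx N → K) (α : K) {j : ℕ} (h : (j : ℕ∞) < N) :
    coord (lineOf p α) j = lineSeq (coord p) (coord p 0 + α) j := coord_of_lt _ h

lemma coord_pointOf (l : Idx N → K) (α : K) {j : ℕ} (h : (j : ℕ∞) < N) :
    coord (pointOf l α) j = pointSeq (coord l) (coord l 0 + α) j := coord_of_lt _ h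

lemma coord_lineOf_zero (p : Idx N → K) (α : K) (h : ((0 : ℕ) : ℕ∞) < N) :
    coord (lineOf p α) 0 = coord p 0 + α := by
  rw [coord_lineOf _ _ h, lineSeq]

lemma coord_lineOf_one (p : Idx N → K) (α : K) (h : ((1 : ℕ) : ℕ∞) < N) :
    coord (lineOf p α) 1 = coord p 1 + (coord p 0 + α) * coord p 0 := by
  rw [coord_lineOf _ _ h, lineSeq]

lemma coord_lineOf_two (p : Idx N → K) (α : K) (h : ((2 : ℕ) : ℕ∞) < N) :
    coord (lineOf p α) 2 = coord p 2 + coord (lineOf p α) 1 * coord p 0 := by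
  rw [coord_lineOf _ _ h, coord_lineOf_one _ _ (lt_of_le_lt one_le_two h), lineSeq, lineSeq]

lemma coord_lineOf_of_mod (p : Idx N → K) (α : K) {j : ℕ}
    (hj : (j + 3) % 4 = 0 ∨ (j + 3) % 4 = 3) (h : ((j + 3 : ℕ) : ℕ∞) < N) :
    coord (lineOf p α) (j + 3) = coord p (j + 3) + (coord p 0 + α) * coord p (j + 1) := by
  rw [coord_lineOf _ _ h, lineSeq, if_pos hj]

lemma coord_lineOf_of_not_mod (p : Idx N → K) (α : K) {j : ℕ}
    (hj : ¬((j + 3) % 4 = 0 ∨ (j + 3) % 4 = 3)) (h : ((j + 3 : ℕ) : ℕ∞) < N) :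
    coord (lineOf p α) (j + 3) = coord p (j + 3) + coord (lineOf p α) (j + 1) * coord p 0 := by
  rw [coord_lineOf _ _ h, coord_lineOf _ _ (lt_of_le_lt (by omega) h), lineSeq, if_neg hj]

lemma coord_pointOf_zero (l : Idx N → K) (α : K) (h : ((0 : ℕ) : ℕ∞) < N) :
    coord (pointOf l α) 0 = coord l 0 + α := by
  rw [coord_pointOf _ _ h, pointSeq]

lemma coord_pointOf_one (l : Idx N → K) (α : K) (h : ((1 : ℕ) : ℕ∞) < N) :
    coord (pointOf l α) 1 = coord l 1 - coord l 0 * (coord l 0 + α) := by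
  rw [coord_pointOf _ _ h, pointSeq]

lemma coord_pointOf_two (l : Idx N → K) (α : K) (h : ((2 : ℕ) : ℕ∞) < N) :
    coord (pointOf l α) 2 = coord l 2 - coord l 1 * (coord l 0 + α) := by
  rw [coord_pointOf _ _ h, pointSeq]

lemma coord_pointOf_of_mod (l : Idx N → K) (α : K) {j : ℕ}
    (hj : (j + 3) % 4 = 0 ∨ (j + 3) % 4 = 3) (h : ((j + 3 : ℕ) : ℕ∞) < N) :
    coord (pointOf l α) (j + 3) = coord l (j + 3) - coord l 0 * coord (pointOf l α) (j + 1) := by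
  rw [coord_pointOf _ _ h, coord_pointOf _ _ (lt_of_le_lt (by omega) h), pointSeq, if_pos hj]

lemma coord_pointOf_of_not_mod (l : Idx N → K) (α : K) {j : ℕ}
    (hj : ¬((j + 3) % 4 = 0 ∨ (j + 3) % 4 = 3)) (h : ((j + 3 : ℕ) : ℕ∞) < N) :
    coord (pointOf l α) (j + 3) = coord l (j + 3) - coord l (j + 1) * (coord l 0 + α) := by
  rw [coord_pointOf _ _ h, pointSeq, if_neg hj]

/-- Here and in the next lemmas the products with the varying first coordinate cancel between the
two moves; only the scalar α + β survives as a factor. -/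
lemma coord_pointOf_lineOf_zero (p : Idx N → K) (α β : K) (h : ((0 : ℕ) : ℕ∞) < N) :
    coord (pointOf (lineOf p α) β) 0 = coord p 0 + (α + β) := by
  rw [coord_pointOf_zero _ _ h, coord_lineOf_zero _ _ h, add_assoc]

lemma coord_pointOf_lineOf_one (p : Idx N → K) (α β : K) (h : ((1 : ℕ) : ℕ∞) < N) :
    coord (pointOf (lineOf p α) β) 1 = coord p 1 - (α + β) * coord (lineOf p α) 0 := by
  rw [coord_pointOf_one _ _ h, coord_lineOf_one _ _ h,
    coord_lineOf_zero _ _ (lt_of_le_lt zero_le_one h)]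
  ring

lemma coord_pointOf_lineOf_two (p : Idx N → K) (α β : K) (h : ((2 : ℕ) : ℕ∞) < N) :
    coord (pointOf (lineOf p α) β) 2 = coord p 2 - (α + β) * coord (lineOf p α) 1 := by
  rw [coord_pointOf_two _ _ h, coord_lineOf_two _ _ h,
    coord_lineOf_zero _ _ (lt_of_le_lt zero_le_two h)]
  ring

lemma coord_pointOf_lineOf_of_not_mod (p : Idx N → K) (α β : K) {j : ℕ}
    (hj : ¬((j + 3) % 4 = 0 ∨ (j + 3) % 4 = 3)) (h : ((j + 3 : ℕ) : ℕ∞) < N) :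
    coord (pointOf (lineOf p α) β) (j + 3) =
      coord p (j + 3) - (α + β) * coord (lineOf p α) (j + 1) := by
  rw [coord_pointOf_of_not_mod _ _ hj h, coord_lineOf_of_not_mod _ _ hj h,
    coord_lineOf_zero _ _ (lt_of_le_lt (Nat.zero_le _) h)]
  ring

lemma coord_lineOf_pointOf_one (l : Idx N → K) (α β : K) (h : ((1 : ℕ) : ℕ∞) < N) :
    coord (lineOf (pointOf l α) β) 1 = coord l 1 + (α + β) * coord (pointOf l α) 0 := by
  rw [coord_lineOf_one _ _ h, coord_pointOf_one _ _ h,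
    coord_pointOf_zero _ _ (lt_of_le_lt zero_le_one h)]
  ring

lemma coord_lineOf_pointOf_of_mod (l : Idx N → K) (α β : K) {j : ℕ}
    (hj : (j + 3) % 4 = 0 ∨ (j + 3) % 4 = 3) (h : ((j + 3 : ℕ) : ℕ∞) < N) :
    coord (lineOf (pointOf l α) β) (j + 3) =
      coord l (j + 3) + (α + β) * coord (pointOf l α) (j + 1) := by
  rw [coord_lineOf_of_mod _ _ hj h, coord_pointOf_of_mod _ _ hj h,
    coord_pointOf_zero _ _ (lt_of_le_lt (Nat.zero_le _) h)]
  ring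

/-! ### Words of colours: free and cyclic reduction -/

lemma walk_cons_apply (α : K) (w : List K) (v : Vertex N K) :
    walk N (α :: w) v = walk N w (step α v) := rfl

lemma walk_append (u w : List K) : walk N (u ++ w) = walk N w * walk N u := by
  induction u with
  | nil => simp [walk]
  | cons α u ih => rw [List.cons_append, walk, ih, walk, mul_assoc]

lemma stepPerm_neg (α : K) : stepPerm N (-α) = (stepPerm N α)⁻¹ := Equiv.ext fun _ => rfl

lemma walk_map_neg_reverse (w : List K) : walk N (w.map Neg.neg).reverse = (walk N w)⁻¹ := by
  induction w with
  | nil => simp [walk]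
  | cons α w ih =>
    rw [List.map_cons, List.reverse_cons, walk_append, ih, walk, walk, walk, stepPerm_neg, one_mul,
      mul_inv_rev]

lemma exists_eq_walk (g : GD N K) : ∃ w : List K, Even w.length ∧ g.1 = walk N w := by
  obtain ⟨g, hg⟩ := g
  induction hg using Subgroup.closure_induction with
  | mem g hg => exact hg
  | one => exact ⟨[], by simp, rfl⟩
  | mul a b _ _ iha ihb =>
    obtain ⟨u, hu, ha⟩ := iha
    obtain ⟨v, hv, hb⟩ := ihb
    refine ⟨v ++ u, by simpa using hv.add hu, ?_⟩
    rw [walk_append, ← ha, ← hb]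
  | inv a _ iha =>
    obtain ⟨u, hu, ha⟩ := iha
    refine ⟨(u.map Neg.neg).reverse, by simpa using hu, ?_⟩
    rw [walk_map_neg_reverse, ← ha]

lemma phi_eq_walk {g : GD ⊤ K} {w : List K} (h : g.1 = walk ⊤ w) (n : ℕ) :
    (phi n g).1 = walk n w := by
  refine Equiv.ext fun x => ?_
  obtain ⟨v, rfl⟩ := trunc_surjective n x
  rw [← phi_trunc, h, trunc_walk]

/-- A list of colours without backtracking. -/
abbrev IsReduced (w : List K) : Prop := w.IsChain fun a b => a + b ≠ 0

/-- Free reduction: `N_α` followed by `N_{-α}` is the identity, so such pairs can be deleted, two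
letters at a time. -/
lemma exists_isReduced (w : List K) :
    ∃ u : List K, IsReduced u ∧ (Even u.length ↔ Even w.length) ∧
      ∀ N : ℕ∞, walk N u = walk N w := by
  induction w with
  | nil => exact ⟨[], List.isChain_nil, Iff.rfl, fun _ => rfl⟩
  | cons α w ih =>
    obtain ⟨u, hu, he, hw⟩ := ih
    rcases u with - | ⟨β, u⟩
    · refine ⟨[α], List.isChain_singleton _, ?_, fun N => ?_⟩
      · simp only [List.length_cons, Nat.even_add_one, ← he]
      · rw [walk, hw, ← walk]
    · by_cases hab : α + β = 0
      · refine ⟨u, hu.tail, ?_, fun N => ?_⟩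
        · rw [List.length_cons, Nat.even_add_one, ← he, List.length_cons, Nat.even_add_one, not_not]
        · rw [walk, ← hw, walk, eq_neg_of_add_eq_zero_right hab, stepPerm_neg,
            inv_mul_cancel_right]
      · refine ⟨α :: β :: u, List.isChain_cons_cons.2 ⟨hab, hu⟩, ?_, fun N => ?_⟩
        · rw [List.length_cons, Nat.even_add_one, he, List.length_cons, Nat.even_add_one]
        · rw [walk, hw, ← walk]

/-- Cyclic reduction. -/
lemma exists_cyclically_reduced (N : ℕ∞) (w : List K) (hw : IsReduced w) (he : Even w.length)
    (h0 : w ≠ []) :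
    ∃ v : List K, IsReduced (v ++ v) ∧ Even v.length ∧ v ≠ [] ∧ v.length ≤ w.length ∧
      IsConj (walk N v) (walk N w) := by
  induction hn : w.length using Nat.strong_induction_on generalizing w with
  | _ n ih =>
    subst hn
    rcases w with - | ⟨α, w⟩
    · exact absurd rfl h0
    rcases List.eq_nil_or_concat' w with rfl | ⟨u, β, rfl⟩
    · simp at he
    -- If the last letter is inverse to the first, deleting both conjugates by a single step. That
    -- step swaps points and lines, so the conjugacy is taken in the full permutation group.
    by_cases hab : β + α = 0
    · have hu : u ≠ [] := by
        rintro rfl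
        simp only [List.nil_append, IsReduced, List.isChain_cons_cons] at hw
        exact hw.1 (by rw [add_comm, hab])
      have hur : IsReduced u := (List.isChain_append.1 hw.tail).1
      have hue : Even u.length := by
        simpa [Nat.even_add_one] using he
      obtain ⟨v, h1, h2, h3, h4, h5⟩ := ih u.length (by simp) u hur hue hu rfl
      refine ⟨v, h1, h2, h3, h4.trans (by simp; omega), h5.trans ?_⟩
      rw [isConj_iff]
      refine ⟨(stepPerm N α)⁻¹, ?_⟩
      rw [inv_inv, walk, walk_append, eq_neg_of_add_eq_zero_left hab, walk, walk, stepPerm_neg,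
        one_mul]
    · refine ⟨_, ?_, he, List.cons_ne_nil _ _, le_rfl, IsConj.refl _⟩
      refine hw.append hw ?_
      intro x hx y hy
      rw [← List.cons_append, List.getLast?_concat] at hx
      simp only [Option.mem_def, Option.some.injEq, List.head?_cons] at hx hy
      rwa [← hx, ← hy]

/-- The list of colours `w` repeated `m` times. -/
def repeated {A : Type*} (w : List A) : ℕ → List A
  | 0 => []
  | m + 1 => w ++ repeated w m

lemma length_repeated {A : Type*} (w : List A) (m : ℕ) : (repeated w m).length = m * w.length := by
  induction m with
  | zero => simp [repeated]
  | succ m ih => rw [repeated, List.length_append, ih]; ring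

lemma walk_repeated (w : List K) (m : ℕ) : walk N (repeated w m) = walk N w ^ m := by
  induction m with
  | zero => rfl
  | succ m ih => rw [repeated, walk_append, ih, pow_succ]

lemma isReduced_repeated {w : List K} (h0 : w ≠ []) (h : IsReduced (w ++ w)) (m : ℕ) :
    IsReduced (repeated w m) := by
  obtain ⟨h1, -, h2⟩ := List.isChain_append.1 h
  induction m with
  | zero => exact List.isChain_nil
  | succ m ih =>
    refine h1.append ih fun x hx y hy => h2 x hx y ?_
    cases m with
    | zero => simp [repeated] at hy
    | succ m => rwa [repeated, List.head?_append_of_ne_nil _ h0] at hy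

end Steps
-- Degree at most 3
section Degree

variable {K : Type*} [CommRing K]

/-- The function `f` is given by a polynomial of total degree at most `d`. -/
def IsPolyLE {ι : Type*} (d : ℕ) (f : (ι → K) → K) : Prop :=
  ∃ P : MvPolynomial ι K, P.totalDegree ≤ d ∧ ∀ x, MvPolynomial.eval x P = f x

namespace IsPolyLE

variable {ι : Type*} {d e : ℕ} {f g : (ι → K) → K}

lemma mono (h : IsPolyLE d f) (hde : d ≤ e) : IsPolyLE e f :=
  let ⟨P, h1, h2⟩ := h
  ⟨P, h1.trans hde, h2⟩

lemma const (c : K) : IsPolyLE d fun _ : ι → K => c :=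
  ⟨MvPolynomial.C c, by simp, by simp⟩

lemma apply (i : ι) : IsPolyLE 1 fun x : ι → K => x i := by
  refine ⟨MvPolynomial.X i, ?_, by simp⟩
  rw [MvPolynomial.X]
  exact (MvPolynomial.totalDegree_monomial_le _ _).trans (by simp)

lemma add (hf : IsPolyLE d f) (hg : IsPolyLE d g) : IsPolyLE d fun x => f x + g x := by
  obtain ⟨P, h1, h2⟩ := hf
  obtain ⟨Q, h3, h4⟩ := hg
  exact ⟨P + Q, (MvPolynomial.totalDegree_add _ _).trans (max_le h1 h3), by simp [h2, h4]⟩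

lemma mul (hf : IsPolyLE d f) (hg : IsPolyLE e g) : IsPolyLE (d + e) fun x => f x * g x := by
  obtain ⟨P, h1, h2⟩ := hf
  obtain ⟨Q, h3, h4⟩ := hg
  exact ⟨P * Q, (MvPolynomial.totalDegree_mul _ _).trans (add_le_add h1 h3), by simp [h2, h4]⟩

lemma const_mul (c : K) (hf : IsPolyLE d f) : IsPolyLE d fun x => c * f x := by
  simpa using (const (d := 0) c).mul hf

lemma sub (hf : IsPolyLE d f) (hg : IsPolyLE d g) : IsPolyLE d fun x => f x - g x := by
  simpa [sub_eq_add_neg] using hf.add (hg.const_mul (-1))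

end IsPolyLE

variable {N : ℕ∞}

lemma isPolyLE_coord {j : ℕ} (h : (j : ℕ∞) < N) : IsPolyLE 1 fun p : Idx N → K => coord p j := by
  simpa only [coord_of_lt _ h] using IsPolyLE.apply (K := K) (⟨j, h⟩ : Idx N)

/-- The degree bounds along a walk, for a point that depends on parameters and the line that
follows it: the coordinates of the point that are changed by a multiple of a line coordinate, and
the coordinates of the line that are changed by a multiple of a point coordinate, are quadratic. -/
structure QuadraticFlag (P : (Idx N → K) → Idx N → K) (α : K) : Prop where
  first : ((0 : ℕ) : ℕ∞) < N → IsPolyLE 1 fun x => coord (P x) 0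
  point : ∀ j : ℕ, (j : ℕ∞) < N → ¬(j % 4 = 0 ∨ j % 4 = 3) → IsPolyLE 2 fun x => coord (P x) j
  line : ∀ j : ℕ, (j : ℕ∞) < N → (j = 1 ∨ j % 4 = 0 ∨ j % 4 = 3) →
    IsPolyLE 2 fun x => coord (lineOf (P x) α) j

lemma quadraticFlag_id (α : K) : QuadraticFlag (N := N) id α where
  first h := isPolyLE_coord h
  point j h _ := (isPolyLE_coord h).mono one_le_two
  line j h hj := by
    have h0 : ((0 : ℕ) : ℕ∞) < N := lt_of_le_lt (Nat.zero_le _) h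
    have hy : IsPolyLE 1 fun x : Idx N → K => coord x 0 + α :=
      (isPolyLE_coord h0).add (IsPolyLE.const α)
    match j, h, hj with
    | 0, h, _ =>
      simpa only [id, coord_lineOf_zero _ _ h] using hy.mono one_le_two
    | 1, h, _ =>
      simpa only [id, coord_lineOf_one _ _ h] using
        ((isPolyLE_coord h).mono one_le_two).add (hy.mul (isPolyLE_coord h0))
    | 2, _, hj => omega
    | j + 3, h, hj =>
      simpa only [id, coord_lineOf_of_mod _ _ (hj.resolve_left (by omega)) h] using
        ((isPolyLE_coord h).mono one_le_two).add
          (hy.mul (isPolyLE_coord (lt_of_le_lt (by omega) h)))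

namespace QuadraticFlag

variable {P : (Idx N → K) → Idx N → K} {α : K}

lemma first_line (hP : QuadraticFlag P α) (h : ((0 : ℕ) : ℕ∞) < N) :
    IsPolyLE 1 fun x => coord (lineOf (P x) α) 0 := by
  simpa only [coord_lineOf_zero _ _ h] using (hP.first h).add (IsPolyLE.const α)

lemma first_next (hP : QuadraticFlag P α) (β : K) (h : ((0 : ℕ) : ℕ∞) < N) :
    IsPolyLE 1 fun x => coord (pointOf (lineOf (P x) α) β) 0 := by
  simpa only [coord_pointOf_lineOf_zero _ _ _ h] using (hP.first h).add (IsPolyLE.const (α + β))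

lemma point_next (hP : QuadraticFlag P α) (β : K) {j : ℕ} (h : (j : ℕ∞) < N)
    (hj : ¬(j % 4 = 0 ∨ j % 4 = 3)) :
    IsPolyLE 2 fun x => coord (pointOf (lineOf (P x) α) β) j := by
  have h0 : ((0 : ℕ) : ℕ∞) < N := lt_of_le_lt (Nat.zero_le _) h
  match j, h, hj with
  | 0, _, hj => omega
  | 1, h, hj =>
    simpa only [coord_pointOf_lineOf_one _ _ _ h] using
      (hP.point 1 h hj).sub (((hP.first_line h0).mono one_le_two).const_mul _)
  | 2, h, hj =>
    simpa only [coord_pointOf_lineOf_two _ _ _ h] using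
      (hP.point 2 h hj).sub
        ((hP.line 1 (lt_of_le_lt one_le_two h) (Or.inl rfl)).const_mul _)
  | j + 3, h, hj =>
    simpa only [coord_pointOf_lineOf_of_not_mod _ _ _ hj h] using
      (hP.point _ h hj).sub
        ((hP.line (j + 1) (lt_of_le_lt (by omega) h) (by omega)).const_mul _)

/-- Only constant multiples of quadratics are added, so the bounds do not grow with the length of
the walk. -/
lemma next (hP : QuadraticFlag P α) (β γ : K) :
    QuadraticFlag (fun x => pointOf (lineOf (P x) α) β) γ where
  first h := hP.first_next β h
  point _ h hj := hP.point_next β h hj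
  line j h hj := by
    have h0 : ((0 : ℕ) : ℕ∞) < N := lt_of_le_lt (Nat.zero_le _) h
    match j, h, hj with
    | 0, h, _ =>
      simpa only [coord_lineOf_zero _ _ h] using
        ((hP.first_next β h).add (IsPolyLE.const γ)).mono one_le_two
    | 1, h, _ =>
      simpa only [coord_lineOf_pointOf_one _ _ _ h] using
        (hP.line 1 h (Or.inl rfl)).add (((hP.first_next β h0).mono one_le_two).const_mul _)
    | 2, _, hj => omega
    | j + 3, h, hj =>
      have hj' := hj.resolve_left (by omega)
      simpa only [coord_lineOf_pointOf_of_mod _ _ _ hj' h] using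
        (hP.line _ h hj).add
          ((hP.point_next β (j := j + 1) (lt_of_le_lt (by omega) h) (by omega)).const_mul _)

/-- The one place where degree 3 appears: the linear `l_1` times a quadratic point coordinate. These
coordinates are not part of the flag, so they never feed back into it. -/
lemma cubic_next (hP : QuadraticFlag P α) (β : K) {j : ℕ} (h : (j : ℕ∞) < N) :
    IsPolyLE 3 fun x => coord (pointOf (lineOf (P x) α) β) j := by
  have h0 : ((0 : ℕ) : ℕ∞) < N := lt_of_le_lt (Nat.zero_le _) h
  by_cases hj : j % 4 = 0 ∨ j % 4 = 3
  · match j, h, hj with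
    | 0, h, _ => exact (hP.first_next β h).mono (by norm_num)
    | 1, _, hj => omega
    | 2, _, hj => omega
    | j + 3, h, hj =>
      simpa only [coord_pointOf_of_mod _ _ hj h] using
        ((hP.line _ h (Or.inr hj)).mono (by norm_num)).sub
          ((hP.first_line h0).mul
            (hP.point_next β (j := j + 1) (lt_of_le_lt (by omega) h) (by omega)))
  · exact (hP.point_next β h hj).mono (by norm_num)

lemma exists_walk_eq (w : List K) (hw : Odd w.length) {P : (Idx N → K) → Idx N → K} {α : K}
    (hP : QuadraticFlag P α) :
    ∃ Q : (Idx N → K) → Idx N → K, (∀ x, walk N w (.inr (lineOf (P x) α)) = .inl (Q x)) ∧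
      ∀ j : ℕ, (j : ℕ∞) < N → IsPolyLE 3 fun x => coord (Q x) j := by
  match w, hw with
  | [], hw => simp at hw
  | [β], _ => exact ⟨_, fun x => rfl, fun j h => hP.cubic_next β h⟩
  | β :: γ :: w, hw =>
    refine exists_walk_eq w ?_ (hP.next β γ)
    simpa [Nat.odd_add_one] using hw
termination_by w.length

end QuadraticFlag

lemma hasDegreeLE_pointMap (g : GD N K) : HasDegreeLE (pointMap g) 3 := by
  obtain ⟨w, hw, hg⟩ := exists_eq_walk g
  suffices ∀ i, IsPolyLE 3 fun x => pointMap g x i by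
    choose P h1 h2 using this
    exact ⟨P, h1, fun x i => h2 i x⟩
  rcases w with - | ⟨α, w⟩
  · have : g = 1 := Subtype.ext hg
    subst this
    intro i
    simpa only [pointMap_one] using (IsPolyLE.apply i).mono (by norm_num)
  · obtain ⟨Q, h1, h2⟩ := (quadraticFlag_id (N := N) α).exists_walk_eq w
      (by simpa [Nat.even_add_one] using hw)
    have : ∀ x, pointMap g x = Q x := fun x => by
      refine Sum.inl_injective (β := Idx N → K) ?_
      rw [inl_pointMap, hg, ← h1]
      rfl
    rintro ⟨j, hj⟩
    simpa only [this, coord_of_lt _ hj] using h2 j hj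

lemma HasDegreeLE.exists_hasDegree {ι : Type*} {f : (ι → K) → ι → K} {d : ℕ}
    (h : HasDegreeLE f d) : ∃ e, HasDegree f e := by
  classical
  exact ⟨Nat.find ⟨d, h⟩, Nat.find_spec ⟨d, h⟩, fun _ he => Nat.find_min' _ he⟩

/-- Between the lines `{x eᵢ}` and `{x eᵢ + eⱼ}`, a quadratic function varies linearly. -/
lemma IsPolyLE.exists_sub_eq_affine {ι : Type*} [DecidableEq ι] {f : (ι → K) → K}
    (hf : IsPolyLE 2 f) {i j : ι} (hij : i ≠ j) :
    ∃ b c : K, ∀ x, f (Pi.single i x + Pi.single j 1) - f (Pi.single i x) = b + c * x := by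
  obtain ⟨P, hP, hf⟩ := hf
  -- Monomial by monomial: without the variable `j` the two values agree; with a third variable both
  -- vanish; otherwise `j` uses up one degree and the exponent of `i` is at most 1.
  have key : ∀ d : ι →₀ ℕ, d.degree ≤ 2 → ∃ b c : K, ∀ x,
      (d.prod fun k m => (Pi.single i x + Pi.single j 1 : ι → K) k ^ m) -
        (d.prod fun k m => (Pi.single i x : ι → K) k ^ m) = b + c * x := by
    intro d hd
    by_cases hj : d j = 0
    · refine ⟨0, 0, fun x => ?_⟩
      rw [zero_mul, zero_add, sub_eq_zero]
      refine Finsupp.prod_congr fun k hk => ?_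
      have : k ≠ j := by rintro rfl; exact Finsupp.mem_support_iff.1 hk hj
      simp [this]
    · have h0 : ∀ x, (d.prod fun k m => (Pi.single i x : ι → K) k ^ m) = 0 := fun x =>
        Finset.prod_eq_zero (Finsupp.mem_support_iff.2 hj) (by simp [hij.symm, hj])
      by_cases hk : ∃ k, k ≠ i ∧ k ≠ j ∧ d k ≠ 0
      · obtain ⟨k, hki, hkj, hk⟩ := hk
        refine ⟨0, 0, fun x => ?_⟩
        rw [h0, Finsupp.prod, Finset.prod_eq_zero (Finsupp.mem_support_iff.2 hk)
          (by simp [hki, hkj, hk])]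
        simp
      · push Not at hk
        have hsub : d.support ⊆ {i, j} := fun k hks => by
          by_contra hn
          simp only [Finset.mem_insert, Finset.mem_singleton, not_or] at hn
          exact Finsupp.mem_support_iff.1 hks (hk k hn.1 hn.2)
        have hdi : d i ≤ 1 := by
          have : d i + d j ≤ d.degree := by
            rw [Finsupp.degree_apply, Finset.sum_subset hsub (by simp), Finset.sum_pair hij]
          omega
        have h1 : ∀ x, (d.prod fun k m => (Pi.single i x + Pi.single j 1 : ι → K) k ^ m) =
            x ^ d i := fun x => by
          rw [Finsupp.prod_of_support_subset _ hsub _ (by simp), Finset.prod_pair hij]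
          simp [hij, hij.symm]
        rcases Nat.le_one_iff_eq_zero_or_eq_one.1 hdi with h | h
        · exact ⟨1, 0, fun x => by rw [h0, h1, h]; simp⟩
        · exact ⟨0, 1, fun x => by rw [h0, h1, h]; simp⟩
  have hdeg : ∀ d ∈ P.support, d.degree ≤ 2 := fun d hd =>
    (MvPolynomial.le_totalDegree hd).trans hP
  choose! b c hbc using key
  refine ⟨∑ d ∈ P.support, P.coeff d * b d, ∑ d ∈ P.support, P.coeff d * c d, fun x => ?_⟩
  rw [← hf, ← hf, MvPolynomial.eval_eq, MvPolynomial.eval_eq, ← Finset.sum_sub_distrib,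
    Finset.sum_mul, ← Finset.sum_add_distrib]
  refine Finset.sum_congr rfl fun d hd => ?_
  rw [← mul_sub]
  exact (congrArg _ (hbc d (hdeg d hd) x)).trans (by ring)

end Degree
-- Growth of the chains along a reduced walk
section Chain

variable {K : Type*} [CommRing K]

/-- The sequence `p₁, p₁₂, p₂₃, p₃₄, …` of coordinates of a point. -/
def pointChain (p : Idx ⊤ → K) (r : ℕ) : K := coord p (4 * r - 2)

/-- The sequence `-1, l₁₁, l₂₂, l₃₃, …`, where the latter are coordinates of a line. -/
def lineChain (l : Idx ⊤ → K) : ℕ → K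
  | 0 => -1
  | 1 => coord l 1
  | r + 2 => coord l (4 * r + 4)

/-- The entry -1 of `lineChain` makes the translation of `p_1` fit the same rule. On the other side,
truncated subtraction puts `p_1` at position `4 * 0 - 2 = 0`. -/
lemma pointChain_pointOf_lineOf (p : Idx ⊤ → K) (α β : K) :
    pointChain (pointOf (lineOf p α) β) =
      pointChain p - (α + β) • lineChain (lineOf p α) := by
  funext r
  match r with
  | 0 =>
    simp only [pointChain, lineChain, Pi.sub_apply, Pi.smul_apply, smul_eq_mul]
    rw [coord_pointOf_lineOf_zero _ _ _ (ENat.natCast_lt_top 0)]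
    ring
  | 1 => exact coord_pointOf_lineOf_two _ _ _ (ENat.natCast_lt_top 2)
  | r + 2 =>
    exact coord_pointOf_lineOf_of_not_mod (j := 4 * r + 3) _ _ _ (by omega)
      (ENat.natCast_lt_top _)

lemma lineChain_lineOf_pointOf_succ (l : Idx ⊤ → K) (α β : K) (r : ℕ) :
    lineChain (lineOf (pointOf l α) β) (r + 1) =
      lineChain l (r + 1) + (α + β) * pointChain (pointOf l α) r := by
  match r with
  | 0 => exact coord_lineOf_pointOf_one _ _ _ (ENat.natCast_lt_top 1)
  | r + 1 =>
    exact coord_lineOf_pointOf_of_mod (j := 4 * r + 1) _ _ _ (by omega) (ENat.natCast_lt_top _)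

/-- Multiplication by `z` of a sequence of coefficients. -/
def shift : (ℕ → K) →ₗ[K] ℕ → K where
  toFun X r := Nat.casesOn r 0 X
  map_add' X Y := funext fun r => by cases r <;> simp
  map_smul' c X := funext fun r => by cases r <;> simp

lemma lineChain_lineOf_pointOf (l : Idx ⊤ → K) (α β : K) :
    lineChain (lineOf (pointOf l α) β) =
      lineChain l + (α + β) • shift (pointChain (pointOf l α)) := by
  funext r
  cases r with
  | zero => simp [shift, lineChain]
  | succ r => simp [shift, lineChain_lineOf_pointOf_succ]

/-- A walk without backtracking of even length `2m` that starts on a line `l` with preceding point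
`p` acts linearly on the chains of `p` and `l`, with nonzero top coefficient. -/
lemma exists_chain_transfer [IsDomain K] (w : List K) (m : ℕ) (hm : w.length = 2 * m) (α β : K)
    (hw : IsReduced (α :: (w ++ [β]))) :
    ∃ (T U : (ℕ → K) × (ℕ → K) →ₗ[K] ℕ → K) (γ c s : K), γ + β ≠ 0 ∧ c ≠ 0 ∧
      (∀ X Y b, (∀ r, b ≤ r → X r = 0) → (∀ r, b < r → Y r = 0) →
        (∀ r, b + m ≤ r → T (X, Y) r = 0) ∧ (∀ r, b + m < r → U (X, Y) r = 0) ∧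
        U (X, Y) (b + m) = c * Y b) ∧
      ∀ p, ∃ q, walk ⊤ w (.inr (lineOf p α)) = .inr (lineOf q γ) ∧
        coord q 0 = coord p 0 + s ∧
        pointChain q = T (pointChain p, lineChain (lineOf p α)) ∧
        lineChain (lineOf q γ) = U (pointChain p, lineChain (lineOf p α)) := by
  induction m generalizing w α with
  | zero =>
    obtain rfl : w = [] := List.eq_nil_of_length_eq_zero hm
    refine ⟨LinearMap.fst K _ _, LinearMap.snd K _ _, α, 1, 0, ?_, one_ne_zero,
      fun X Y b hX hY => ⟨hX, hY, by simp⟩, fun p => ⟨p, rfl, by simp, rfl, rfl⟩⟩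
    simpa [IsReduced] using hw
  | succ m ih =>
    match w, hm, hw with
    | a :: a' :: w, hm, hw =>
      simp only [List.cons_append, IsReduced, List.isChain_cons_cons] at hw
      obtain ⟨ha, ha', hw⟩ := hw
      obtain ⟨T, U, γ, c, s, hγ, hc, htop, hwalk⟩ :=
        ih w (by simp only [List.length_cons] at hm; omega) a' hw
      -- `A` and `B` give the chains of the next point and the next line, after the moves `a` and
      -- `a'`.
      let A : (ℕ → K) × (ℕ → K) →ₗ[K] ℕ → K :=
        LinearMap.fst K _ _ - (α + a) • LinearMap.snd K _ _
      let B : (ℕ → K) × (ℕ → K) →ₗ[K] ℕ → K :=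
        LinearMap.snd K _ _ + (a + a') • shift ∘ₗ A
      -- The top coefficient `Y b` enters `A` at place `b` with factor -(α + a), then `B` at place
      -- `b + 1` with factor `a + a'`.
      refine ⟨T ∘ₗ A.prod B, U ∘ₗ A.prod B, γ, -(c * ((a + a') * (α + a))), s + (α + a), hγ,
        neg_ne_zero.2 (mul_ne_zero hc (mul_ne_zero ha' ha)), fun X Y b hX hY => ?_, fun p => ?_⟩
      · have hA : ∀ r, A (X, Y) r = X r - (α + a) * Y r := fun r => rfl
        have hB : ∀ r, B (X, Y) (r + 1) = Y (r + 1) + (a + a') * A (X, Y) r := fun r => rfl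
        have h1 : ∀ r, b + 1 ≤ r → A (X, Y) r = 0 := fun r hr => by
          rw [hA, hX r (by omega), hY r (by omega)]; ring
        have h2 : ∀ r, b + 1 < r → B (X, Y) r = 0 := fun r hr => by
          obtain ⟨r, rfl⟩ : ∃ r', r = r' + 1 := ⟨r - 1, by omega⟩
          rw [hB, h1 r (by omega), hY _ (by omega)]; ring
        obtain ⟨h3, h4, h5⟩ := htop _ _ (b + 1) h1 h2
        refine ⟨fun r hr => h3 r (by omega), fun r hr => h4 r (by omega), ?_⟩
        rw [show b + (m + 1) = b + 1 + m by ring]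
        refine h5.trans ?_
        rw [hB, hA, hX b le_rfl, hY (b + 1) (by omega)]
        ring
      · obtain ⟨q, h1, h2, h3, h4⟩ := hwalk (pointOf (lineOf p α) a)
        have hA : pointChain (pointOf (lineOf p α) a) =
            A (pointChain p, lineChain (lineOf p α)) := pointChain_pointOf_lineOf _ _ _
        have hB : lineChain (lineOf (pointOf (lineOf p α) a) a') =
            B (pointChain p, lineChain (lineOf p α)) := by
          rw [lineChain_lineOf_pointOf, hA]; rfl
        rw [hA, hB] at h3 h4
        refine ⟨q, h1, ?_, h3, h4⟩
        rw [h2, coord_pointOf_lineOf_zero _ _ _ (ENat.natCast_lt_top 0)]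
        ring

/-- A walk without backtracking of length `2(m+1)` moves the coordinate in position `4m-2` (or `0`)
of the point `0`. -/
lemma walk_zero_ne [IsDomain K] (w : List K) (m : ℕ) (hm : w.length = 2 * (m + 1))
    (hw : IsReduced w) :
    ∃ q : Idx ⊤ → K, walk ⊤ w (.inl 0) = .inl q ∧ coord q (4 * m - 2) ≠ 0 := by
  rcases w with - | ⟨α, w⟩
  · simp at hm
  rcases List.eq_nil_or_concat' w with rfl | ⟨u, β, rfl⟩
  · simp at hm; omega
  obtain ⟨T, U, γ, c, s, hγ, hc, htop, hwalk⟩ :=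
    exists_chain_transfer u m (by simp at hm; omega) α β hw
  obtain ⟨q, h1, -, h3, h4⟩ := hwalk 0
  have hz : ∀ j, coord (0 : Idx ⊤ → K) j = 0 := fun j => by
    rw [coord_of_lt _ (ENat.natCast_lt_top j)]; rfl
  -- The chains at the start are X = 0 and Y = (-1, 0, 0, …), so the top place is `b = 0`.
  obtain ⟨h5, -, h6⟩ := htop (pointChain 0) (lineChain (lineOf 0 α)) 0 (fun r _ => hz _)
    fun r hr => by
    match r, hr with
    | 1, _ =>
      simp [lineChain, coord_lineOf_one _ _ (ENat.natCast_lt_top 1), hz]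
    | r + 2, _ =>
      refine (coord_lineOf_of_mod (j := 4 * r + 1) _ _ (by omega) (ENat.natCast_lt_top _)).trans ?_
      simp [hz]
  refine ⟨pointOf (lineOf q γ) β, ?_, ?_⟩
  · rw [walk_cons_apply, step_inl, walk_append, Equiv.Perm.mul_apply, h1]; rfl
  · have := congrFun (pointChain_pointOf_lineOf q γ β) m
    rw [pointChain] at this
    rw [this, h3, h4]
    simp only [Pi.sub_apply, Pi.smul_apply, smul_eq_mul]
    rw [zero_add] at h6
    rw [h5 m (by omega), h6]
    simpa [lineChain] using ⟨hγ, hc⟩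

/-- Along a walk without backtracking of length `2(m+1)`, the points `(x, 0, 0, …)` and
`(x, 0, 1, 0, …)` end at points whose coordinates in position `4m+8` differ by a quadratic function
of `x`. -/
lemma walk_difference [IsDomain K] (w : List K) (m : ℕ) (hm : w.length = 2 * (m + 1))
    (hw : IsReduced w) :
    ∃ C a b : K, C ≠ 0 ∧ ∀ (x : K) (p p' : Idx ⊤ → K),
      (∀ j, coord p j = if j = 0 then x else 0) →
      (∀ j, coord p' j = if j = 0 then x else if j = 2 then 1 else 0) →
      ∃ q q' : Idx ⊤ → K, walk ⊤ w (.inl p) = .inl q ∧ walk ⊤ w (.inl p') = .inl q' ∧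
        coord q' (4 * m + 8) - coord q (4 * m + 8) = C * (x + a) * (x + b) := by
  rcases w with - | ⟨α, w⟩
  · simp at hm
  rcases List.eq_nil_or_concat' w with rfl | ⟨u, β, rfl⟩
  · simp at hm; omega
  obtain ⟨T, U, γ, c, s, hγ, hc, htop, hwalk⟩ :=
    exists_chain_transfer u m (by simp at hm; omega) α β hw
  -- The factor `x + α` is `l_1` on the first line, which multiplies the changed `p_12`; the factor
  -- `x + s + γ` is `l_1` on the last line.
  refine ⟨(γ + β) * c, s + γ, α, mul_ne_zero hγ hc, fun x p p' hp hp' => ?_⟩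
  obtain ⟨q, h1, h2, h3, h4⟩ := hwalk p
  obtain ⟨q', h1', h2', h3', h4'⟩ := hwalk p'
  have hY : ∀ r, 2 ≤ r → (lineChain (lineOf p' α) - lineChain (lineOf p α)) r =
      if r = 2 then x + α else 0 := fun r hr => by
    obtain ⟨r, rfl⟩ : ∃ r', r = r' + 2 := ⟨r - 2, by omega⟩
    have h5 := fun v : Idx ⊤ → K =>
      coord_lineOf_of_mod (j := 4 * r + 1) v α (by omega) (ENat.natCast_lt_top _)
    simp only [Pi.sub_apply, lineChain]
    rw [show 4 * r + 4 = 4 * r + 1 + 3 by ring, h5, h5]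
    simp [hp, hp']
  -- By linearity the transfer applies to the differences of the chains, whose top place is 2:
  -- `l_22` differs by `x + α`.
  obtain ⟨h5, h6, h7⟩ := htop (pointChain p' - pointChain p)
    (lineChain (lineOf p' α) - lineChain (lineOf p α)) 2
    (fun r hr => by
      have h8 : 4 * r - 2 ≠ 0 := by omega
      have h9 : 4 * r - 2 ≠ 2 := by omega
      simp only [Pi.sub_apply, pointChain, hp, hp', if_neg h8, if_neg h9, sub_self])
    (fun r hr => by rw [hY r hr.le, if_neg (by omega)])
  rw [← Prod.mk_sub_mk, map_sub] at h5 h6 h7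
  rw [← h3, ← h3'] at h5
  rw [← h4, ← h4'] at h6 h7
  rw [hY 2 le_rfl, if_pos rfl] at h7
  refine ⟨pointOf (lineOf q γ) β, pointOf (lineOf q' γ) β, ?_, ?_, ?_⟩
  · rw [walk_cons_apply, step_inl, walk_append, Equiv.Perm.mul_apply, h1]; rfl
  · rw [walk_cons_apply, step_inl, walk_append, Equiv.Perm.mul_apply, h1']; rfl
  · have hlast := fun v : Idx ⊤ → K =>
      coord_pointOf_of_mod (j := 4 * m + 5) (lineOf v γ) β (by omega) (ENat.natCast_lt_top _)
    have hprev := fun v : Idx ⊤ → K => congrFun (pointChain_pointOf_lineOf v γ β) (m + 2)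
    simp only [pointChain, Pi.sub_apply, Pi.smul_apply, smul_eq_mul] at hprev
    have hfirst := fun v : Idx ⊤ → K => coord_lineOf_zero v γ (ENat.natCast_lt_top 0)
    have e1 := h5 (m + 2) (by omega)
    have e2 := h6 (m + 3) (by omega)
    rw [add_comm 2 m] at h7
    simp only [Pi.sub_apply, pointChain, lineChain] at e1 e2 h7
    have hp0 : coord q 0 = x + s := by rw [h2, hp]; simp
    have hp0' : coord q' 0 = x + s := by rw [h2', hp']; simp
    rw [hlast, hlast, hfirst, hfirst, hp0, hp0', show 4 * m + 5 + 1 = 4 * (m + 2) - 2 by omega,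
      hprev, hprev]
    simp only [lineChain]
    rw [show 4 * (m + 1) + 4 = 4 * m + 5 + 3 by ring] at e2
    linear_combination e2 - (x + s + γ) * e1 + (x + s + γ) * (γ + β) * h7

end Chain
-- Orders of walks
section Order

instance finite_idx (n : ℕ) : Finite (Idx (n : ℕ∞)) :=
  Finite.of_injective (fun j => (⟨j.1, by exact_mod_cast j.2⟩ : Fin n)) fun i j h =>
    Subtype.ext (congrArg Fin.val h)

variable {K : Type*} [CommRing K] [IsDomain K]

lemma walk_ne_one {w : List K} (hw : IsReduced w) {m n : ℕ} (hm : w.length = 2 * (m + 1))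
    (hn : 4 * m - 2 < n) : walk n w ≠ 1 := by
  intro h
  obtain ⟨q, h1, h2⟩ := walk_zero_ne w m hm hw
  have h3 := trunc_walk n w (.inl 0)
  rw [h1, h] at h3
  have h4 := congrFun (Sum.inl_injective h3) ⟨4 * m - 2, by exact_mod_cast hn⟩
  exact h2 ((coord_of_lt _ (ENat.natCast_lt_top _)).trans h4)

/-- The power is conjugate to a reduced walk of length `2k't` with `k' ≤ k`, which moves position
`4(k't - 1) - 2`, read as 0 when `k't = 1`. The bound on `kt` keeps this position below `n`. -/
lemma walk_pow_ne_one {w : List K} (hw : IsReduced w) (h0 : w ≠ []) {k n t : ℕ}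
    (hk : w.length = 2 * k) (ht : 0 < t) (hn : 0 < n) (hkt : 4 * (k * t) < n + 6) :
    walk n w ^ t ≠ 1 := by
  obtain ⟨v, h1, ⟨k', hk'⟩, h3, h4, h5⟩ := exists_cyclically_reduced n w hw ⟨k, by omega⟩ h0
  intro h
  have hv : walk n (repeated v t) = 1 := by
    rw [walk_repeated]
    have := h5.pow t
    rwa [h, isConj_one_left] at this
  have hpos : 0 < k' := by
    have := List.length_pos_of_ne_nil h3
    omega
  have hkt' : k' * t ≤ k * t := Nat.mul_le_mul_right _ (by omega)
  have hpos' : 0 < k' * t := Nat.mul_pos hpos ht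
  refine walk_ne_one (isReduced_repeated h3 h1 t) (m := k' * t - 1) ?_ (by omega) hv
  rw [length_repeated, hk', Nat.sub_add_cancel hpos']
  ring

omit [IsDomain K] in
lemma exists_isReduced_eq_walk {g : GD ⊤ K} (hg : g ≠ 1) :
    ∃ (w : List K) (m : ℕ), IsReduced w ∧ w.length = 2 * (m + 1) ∧ g.1 = walk ⊤ w := by
  obtain ⟨u, hu, h⟩ := exists_eq_walk g
  obtain ⟨w, hw, he, hwu⟩ := exists_isReduced u
  obtain ⟨k, hk⟩ := he.2 hu
  rw [← hwu] at h
  have h0 : k ≠ 0 := by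
    rintro rfl
    rw [List.eq_nil_of_length_eq_zero hk] at h
    exact hg (Subtype.ext h)
  exact ⟨w, k - 1, hw, by omega, h⟩

lemma IsRegular.le_four_mul_orderOf [Finite K] {g : GD ⊤ K} {k : ℕ} (hk : 1 ≤ k)
    (hg : IsRegular g k) {n : ℕ} (hn : 0 < n) : n + 6 ≤ 4 * (k * orderOf (phi n g)) := by
  obtain ⟨w, h1, h2, h3⟩ := hg
  by_contra! h
  refine walk_pow_ne_one h2 (by rintro rfl; simp at h1; omega) h1 (orderOf_pos _) hn h ?_
  rw [← phi_eq_walk h3, ← Subgroup.coe_pow, pow_orderOf_eq_one, Subgroup.coe_one]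

lemma IsRegular.ne_one {g : GD ⊤ K} {k : ℕ} (hk : 1 ≤ k) (hg : IsRegular g k) : g ≠ 1 := by
  rintro rfl
  obtain ⟨w, h1, h2, h3⟩ := hg
  refine walk_ne_one h2 (m := k - 1) (n := 4 * k) (by omega) (by omega) ?_
  rw [← phi_eq_walk h3, map_one, Subgroup.coe_one]

theorem not_isOfFinOrder {g : GD ⊤ K} (hg : g ≠ 1) : ¬IsOfFinOrder g := by
  intro h
  obtain ⟨w, m, h1, h2, h3⟩ := exists_isReduced_eq_walk hg
  obtain ⟨t, ht, h⟩ := isOfFinOrder_iff_pow_eq_one.1 h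
  -- A truncation long enough to show that the `t`-th power acts nontrivially.
  refine walk_pow_ne_one h1 (by rintro rfl; simp at h2) h2 ht
    (n := 4 * ((m + 1) * t) + 1) (by omega) (by omega) ?_
  rw [← phi_eq_walk h3, ← Subgroup.coe_pow, ← map_pow, h, map_one, Subgroup.coe_one]

end Order

/-! ### Degree exactly 3 and stability -/

section StableDegree

variable {F : Type*} [Field F]

lemma eventually_hasDegree_three (hF : ∃ t : F, t ≠ 0 ∧ t ≠ 1) {g : GD ⊤ F} (hg : g ≠ 1) :
    ∀ᶠ n : ℕ in atTop, HasDegree (pointAction (phi n g)) 3 := by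
  obtain ⟨w, m, h1, h2, h3⟩ := exists_isReduced_eq_walk hg
  filter_upwards [eventually_gt_atTop (4 * m + 8)] with n hn
  refine ⟨hasDegreeLE_pointMap _, fun e he => ?_⟩
  by_contra! hlt
  obtain ⟨C, a, b, hC, hdiff⟩ := walk_difference w m h2 h1
  let i : Idx (n : ℕ∞) := ⟨0, by exact_mod_cast (by omega : 0 < n)⟩
  let j : Idx (n : ℕ∞) := ⟨2, by exact_mod_cast (by omega : 2 < n)⟩
  let r : Idx (n : ℕ∞) := ⟨4 * m + 8, by exact_mod_cast hn⟩
  have hij : i ≠ j := fun h => by simpa [i, j] using congrArg Subtype.val h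
  obtain ⟨P, hP, hPe⟩ := he
  -- If the degree were at most 2, position `4m + 8` of the image would respond to switching `p_12`
  -- from 0 to 1 by an affine function of `p_1`.
  obtain ⟨A, B, hAB⟩ := IsPolyLE.exists_sub_eq_affine
    (f := fun x => pointAction (phi n g) x r) ⟨P r, (hP r).trans (by omega), fun x => hPe x r⟩ hij
  have hmap : ∀ p q : Idx ⊤ → F, walk ⊤ w (.inl p) = .inl q → ∀ p₀ : Idx (n : ℕ∞) → F,
      trunc n (.inl p) = .inl p₀ → pointAction (phi n g) p₀ r = coord q (4 * m + 8) := by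
    intro p q hpq p₀ hp₀
    have : Sum.inl (pointMap (phi n g) p₀) = trunc n (.inl q) := by
      rw [inl_pointMap, ← hp₀, phi_eq_walk h3, ← trunc_walk, hpq]
    exact (congrFun (Sum.inl_injective this) r).trans
      (coord_of_lt _ (ENat.natCast_lt_top _)).symm
  have key : ∀ x : F, C * (x + a) * (x + b) = A + B * x := by
    intro x
    let p : Idx ⊤ → F := fun k => if k.1 = 0 then x else 0
    let p' : Idx ⊤ → F := fun k => if k.1 = 0 then x else if k.1 = 2 then 1 else 0
    obtain ⟨q, q', h4, h5, h6⟩ := hdiff x p p' (fun k => coord_of_lt _ (ENat.natCast_lt_top k))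
      fun k => coord_of_lt _ (ENat.natCast_lt_top k)
    have e := hmap p q h4 (Pi.single i x) <| congrArg Sum.inl <| funext fun k => by
      simp only [p, Pi.single_apply, Subtype.ext_iff, i]
    have e' := hmap p' q' h5 (Pi.single i x + Pi.single j 1) <|
      congrArg Sum.inl <| funext fun k => by
        simp only [p', Pi.add_apply, Pi.single_apply, Subtype.ext_iff, i, j]
        split_ifs <;> first | omega | simp
    rw [← hAB, ← h6, e, e']
  obtain ⟨t, ht0, ht1⟩ := hF
  have e0 := key 0
  have e1 := key 1
  have et := key t
  -- The combination of the values at 0, 1 and `t` that kills affine functions isolates the leading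
  -- coefficient.
  have : C * (t * (t - 1)) = 0 := by
    linear_combination et - t * e1 + (t - 1) * e0
  exact mul_ne_zero hC (mul_ne_zero ht0 (sub_ne_zero.2 ht1)) this

lemma exists_ne_zero_ne_one (hF : 3 ≤ Nat.card F) : ∃ t : F, t ≠ 0 ∧ t ≠ 1 := by
  by_contra! h
  have : (Set.univ : Set F) ⊆ {0, 1} := fun t _ => by
    by_cases h0 : t = 0
    · exact Or.inl h0
    · exact Or.inr (h t h0)
  have h1 := (Set.ncard_le_ncard this).trans (Set.ncard_insert_le _ _)
  rw [Set.ncard_univ, Set.ncard_singleton] at h1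
  omega

lemma not_hasDegree_three_one {ι : Type*} :
    ¬HasDegree ((1 : Equiv.Perm (ι → F)) : (ι → F) → ι → F) 3 := by
  intro h
  have h1 : HasDegreeLE ((1 : Equiv.Perm (ι → F)) : (ι → F) → ι → F) 1 :=
    ⟨MvPolynomial.X, fun i => by simp, fun x i => by simp⟩
  exact absurd (h.2 h1) (by norm_num)

/-- Nonzero powers of `g` are nontrivial, so the degree result applies to each of them. It also
forces the orders on points to grow: a power of degree 3 is not the identity. -/
theorem isStableSequence_pointAction [Finite F] (hF : 3 ≤ Nat.card F) {g : GD ⊤ F} (hg : g ≠ 1) :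
    IsStableSequence 3 fun n => pointAction (phi n g) := by
  have hpow : ∀ m : ℤ, m ≠ 0 → ∀ᶠ n : ℕ in atTop,
      HasDegree ((pointAction (phi n g) ^ m : Equiv.Perm _)) 3 := by
    intro m hm
    have hgm : g ^ m ≠ 1 := fun h =>
      not_isOfFinOrder hg (isOfFinOrder_iff_zpow_eq_one.2 ⟨m, hm, h⟩)
    filter_upwards [eventually_hasDegree_three (exists_ne_zero_ne_one hF) hgm] with n hn
    rwa [map_zpow, map_zpow] at hn
  refine ⟨tendsto_atTop.2 fun M => ?_, ?_, hpow⟩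
  -- Only finitely many exponents lie below `M`, so one threshold for `n` serves them all.
  · have : ∀ᶠ n : ℕ in atTop, ∀ t ∈ Finset.Ioo 0 M, pointAction (phi n g) ^ t ≠ 1 := by
      rw [Finset.eventually_all]
      intro t ht
      filter_upwards [hpow t (by simp at ht; omega)] with n hn h
      rw [zpow_natCast, h] at hn
      exact not_hasDegree_three_one hn
    filter_upwards [this] with n hn
    by_contra! hlt
    exact hn _ (Finset.mem_Ioo.2 ⟨orderOf_pos _, hlt⟩) (pow_orderOf_eq_one _)
  · filter_upwards [hpow 1 one_ne_zero] with n hn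
    have hle : ∀ h ∈ Subgroup.zpowers (pointAction (phi n g)), HasDegreeLE h 3 := by
      rintro _ ⟨m, rfl⟩
      simp only [← map_zpow]
      exact hasDegreeLE_pointMap _
    exact ⟨fun h hh => (hle h hh).exists_hasDegree, ⟨_, ⟨1, rfl⟩, hn⟩,
      fun d ⟨h, hh, hd⟩ => hd.2 (hle h hh)⟩

end StableDegree
end WalkForest

open WalkForest in
theorem proposition4 (F : Type*) [Field F] [Finite F] :
    (∀ g : GD ⊤ F, g ≠ 1 → ¬ IsOfFinOrder g) ∧
    (∀ (k : ℕ) (g : GD ⊤ F), 1 ≤ k → IsRegular g k →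
      (∀ n : ℕ, 2 ≤ n → (k : ℝ) ≤ ((n : ℝ) + 5) / 2 →
        ((n : ℝ) + 5) / (4 * (k : ℝ)) ≤ (orderOf (phi n g) : ℝ)) ∧
      (∀ (n : ℕ) (m : ℤ), HasDegreeLE (pointAction (phi n g ^ m)) 3) ∧
      (3 ≤ Nat.card F → IsStableSequence 3 (fun n => pointAction (phi n g)))) := by
  refine ⟨fun g hg => not_isOfFinOrder hg, fun k g hk hg =>
    ⟨fun n hn _ => ?_, fun n m => hasDegreeLE_pointMap _,
      fun hF => isStableSequence_pointAction hF (hg.ne_one hk)⟩⟩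
  have h := hg.le_four_mul_orderOf hk (n := n) (by omega)
  have hk' : (0 : ℝ) < k := by exact_mod_cast hk
  have h' : (n : ℝ) + 6 ≤ 4 * (k * orderOf (phi n g)) := by exact_mod_cast h
  rw [div_le_iff₀ (by positivity)]
  linarith
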